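/- Let $\mathcal G$ be a compact topological group (for instance a compact Lie group) acting on a unital C*-algebra $\mathscr A$ by $*$-automorphisms, written $a\mapsto g(a)$, such that $g\mapsto g(a)$ is norm-continuous for every $a\in\mathscr A$. Let $H$ be a complex Hilbert space and $U$ a strongly continuous unitary representation of $\mathcal G$ on $H$. Fix an orthonormal basis $(e_i)_{i\in I}$ of $H$, let $J x=\sum_i\overline{\langle e_i,x\rangle}\,e_i$, and let $\tau(T)=JT^*J$ be the associated transposition on $B(H)$. A linear map $\phi:\mathscr A\to B(H)$ is called completely positive if, for every $k$, applying $\phi$ entrywise maps positive elements of $\mathbb M_k(\mathscr A)$ to positive elements of $\mathbb M_k(B(H))$; it is called completely copositive if $\tau\circ\phi$ is completely positive, and decomposable if it is the sum of a completely positive and a completely copositive map. It is called $U$-covariant if $\phi(g(a))=U(g)\,\phi(a)\,U(g)^*$ for all $g\in\mathcal G$ and $a\in\mathscr A$. Theorem. A decomposable linear map $\varphi:\mathscr A\to B(H)$ is $U$-covariant if and only if there exist a Hilbert space $K$, a Jordan morphism $\pi:\mathscr A\to B(K)$ (a linear map with $\pi(a^*)=\pi(a)^*$ and $\pi(ab+ba)=\pi(a)\pi(b)+\pi(b)\pi(a)$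 for all $a,b\in\mathscr A$), a bounded linear operator $V:H\to K$ and a strongly continuous unitary representation $Z$ of $\mathcal G$ on $K$ such that, for all $a\in\mathscr A$ and $g\in\mathcal G$, $$\varphi(a)=V^*\pi(a)V,\qquad \pi(g(a))=Z(g)\,\pi(a)\,Z(g)^{-1},\qquad V\,U(g)=Z(g)\,V .$$ -/

import Mathlib

open scoped InnerProductSpace ComplexConjugate

universe u v w

namespace CovariantDecomposable

noncomputable section

/-! ### Transposition on `B(H)` -/

section Transposition

variable {ι : Type*} {H : Type v} [NormedAddCommGroup H] [InnerProductSpace ℂ H]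

/-- The antilinear isometric involution `J x = ∑ i, conj ⟪e i, x⟫ • e i` of complex conjugation
of the coordinates in the orthonormal basis `e`; see `hasSum_conjugation`. -/
def conjugation (e : HilbertBasis ι ℂ H) : H ≃ₗᵢ⋆[ℂ] H :=
  (e.repr.trans (starₗᵢ ℂ)).trans e.repr.symm

theorem hasSum_conjugation (e : HilbertBasis ι ℂ H) (x : H) :
    HasSum (fun i => conj ⟪e i, x⟫_ℂ • e i) (conjugation e x) := by
  have h := e.hasSum_repr_symm (star (e.repr x))
  simpa [conjugation, e.repr_apply_apply] using h

variable [CompleteSpace H]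

/-- The transposition `A ↦ J A* J` on `B(H)` in the orthonormal basis `e`, where `J` is the
complex conjugation in that basis. -/
def transposition (e : HilbertBasis ι ℂ H) : (H →L[ℂ] H) →ₗ[ℂ] (H →L[ℂ] H) where
  toFun A := ((conjugation e : H →L⋆[ℂ] H).comp (ContinuousLinearMap.adjoint A)).comp
    (conjugation e : H →L⋆[ℂ] H)
  map_add' A B := by
    ext x
    simp
  map_smul' c A := by
    ext x
    have h : ContinuousLinearMap.adjoint (c • A) = conj c • ContinuousLinearMap.adjoint A :=
      map_smulₛₗ _ _ _
    simp [h]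

end Transposition

/-! ### Decomposable maps -/

section Decomposable

variable {ι : Type*} {A : Type u} [CStarAlgebra A] [PartialOrder A] [StarOrderedRing A]
  {H : Type v} [NormedAddCommGroup H] [InnerProductSpace ℂ H] [CompleteSpace H]

/-- The linear map `φ : A → B(H)` is completely positive: for every `k`, applying it to the
entries of a positive `k × k` matrix over `A` gives a positive matrix over `B(H)`. -/
def IsCompletelyPositive (φ : A →ₗ[ℂ] (H →L[ℂ] H)) : Prop :=
  ∀ (k : ℕ) (M : CStarMatrix (Fin k) (Fin k) A), 0 ≤ M → 0 ≤ M.map φ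

/-- The linear map `φ : A → B(H)` is completely copositive: its composition with the
transposition of `B(H)` is completely positive. -/
def IsCompletelyCopositive (e : HilbertBasis ι ℂ H) (φ : A →ₗ[ℂ] (H →L[ℂ] H)) : Prop :=
  IsCompletelyPositive (transposition e ∘ₗ φ)

/-- The linear map `φ : A → B(H)` is decomposable: it is the sum of a completely positive and
a completely copositive linear map. -/
def IsDecomposable (e : HilbertBasis ι ℂ H) (φ : A →ₗ[ℂ] (H →L[ℂ] H)) : Prop :=
  ∃ φ₁ φ₂ : A →ₗ[ℂ] (H →L[ℂ] H),
    IsCompletelyPositive φ₁ ∧ IsCompletelyCopositive e φ₂ ∧ φ = φ₁ + φ₂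

end Decomposable

/-! ### Jordan morphisms, representations and covariance -/

section Covariance

variable {A : Type u} [CStarAlgebra A] {G : Type w} [Group G] [TopologicalSpace G]
  {H : Type v} [NormedAddCommGroup H] [InnerProductSpace ℂ H] [CompleteSpace H]

/-- The linear map `π : A → B(H)` is a Jordan morphism: it preserves the involution and the
Jordan product. -/
structure IsJordanMorphism (π : A →ₗ[ℂ] (H →L[ℂ] H)) : Prop where
  map_star : ∀ a, π (star a) = star (π a)
  map_jordan : ∀ a b, π (a * b + b * a) = π a * π b + π b * π a

/-- An action of the topological group `G` on `A` by *-automorphisms is continuous when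
all the orbit maps `g ↦ g(a)` are norm-continuous. -/
def IsContinuousAction (α : G →* (A ≃⋆ₐ[ℂ] A)) : Prop :=
  ∀ a : A, Continuous fun g => α g a

/-- A unitary representation of the topological group `G` on `H` is continuous when all its
orbit maps `g ↦ U(g) x` are norm-continuous. -/
def IsContinuousRep (U : G →* unitary (H →L[ℂ] H)) : Prop :=
  ∀ x : H, Continuous fun g => (U g : H →L[ℂ] H) x

/-- `Ad_u (T) = u T u*`. -/
def Ad (u : unitary (H →L[ℂ] H)) (T : H →L[ℂ] H) : H →L[ℂ] H :=
  (u : H →L[ℂ] H) * T * star (u : H →L[ℂ] H)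

/-- The map `φ : A → B(H)` satisfies `φ ∘ g = Ad_{U(g)} ∘ φ` for all `g ∈ G`. -/
def IsCovariant (α : G →* (A ≃⋆ₐ[ℂ] A)) (U : G →* unitary (H →L[ℂ] H))
    (φ : A →ₗ[ℂ] (H →L[ℂ] H)) : Prop :=
  ∀ (g : G) (a : A), φ (α g a) = Ad (U g) (φ a)

end Covariance

end

end CovariantDecomposable

/-! Write `φ = φ₁ + φ₂` with `φ₁` completely positive and `φ₂` completely copositive. Reversing
products in `A` turns copositivity into positivity, so `Φ (a, op b) = φ₁ a + φ₂ b` is positive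
definite on the C*-algebra `A × Aᵐᵒᵖ` (`isPosDef_coprodOp`). The diagonal `a ↦ (a, op a)` is a
Jordan morphism and `Φ` restricts to `φ` along it, so a Stinespring dilation of `Φ` gives a Jordan
dilation of `φ`.

The summands `φ₁`, `φ₂` need not be covariant, even though `φ` is. Averaging `Φ` over Haar measure
(`IsPosDef.exists_covariant`) makes it covariant, keeps it positive definite, and leaves it alone on
the diagonal, where it is covariant already. The covariant Stinespring theorem
(`IsPosDef.exists_covariant_dilation`) then supplies `π`, `V` and `Z` together. The converse moves
`Z g` through `V* π V` by the intertwining relations. -/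

namespace CovariantDecomposable

open scoped ComplexOrder

/-! ### Positive definite maps and decomposability -/

section PosDef

variable {ι : Type*} {B : Type u} [CStarAlgebra B]
  {H : Type v} [NormedAddCommGroup H] [InnerProductSpace ℂ H]

/-- The linear map `Φ : B → B(H)` is positive definite: the sesquilinear form
`(b ⊗ x, c ⊗ y) ↦ ⟪x, Φ (b* c) y⟫` is positive semidefinite. -/
def IsPosDef (Φ : B →ₗ[ℂ] (H →L[ℂ] H)) : Prop :=
  ∀ (k : ℕ) (b : Fin k → B) (x : Fin k → H),
    0 ≤ ∑ i, ∑ j, ⟪x i, Φ (star (b i) * b j) (x j)⟫_ℂ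

theorem IsPosDef.sum_nonneg {Φ : B →ₗ[ℂ] (H →L[ℂ] H)} (hΦ : IsPosDef Φ) {κ : Type*}
    (s : Finset κ) (b : κ → B) (x : κ → H) :
    0 ≤ ∑ i ∈ s, ∑ j ∈ s, ⟪x i, Φ (star (b i) * b j) (x j)⟫_ℂ := by
  have h := hΦ s.card (fun i => b (s.equivFin.symm i)) (fun i => x (s.equivFin.symm i))
  have key (f : κ → ℂ) : ∑ i, f (s.equivFin.symm i) = ∑ i ∈ s, f i := by
    rw [Equiv.sum_comp s.equivFin.symm (fun i : s => f i), Finset.sum_coe_sort]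
  rw [key fun i => ∑ j, ⟪x i, Φ (star (b i) * b (s.equivFin.symm j)) (x (s.equivFin.symm j))⟫_ℂ]
    at h
  simpa only [fun i => key fun j => ⟪x i, Φ (star (b i) * b j) (x j)⟫_ℂ] using h

theorem inner_self_nonneg_complex (x : H) : 0 ≤ ⟪x, x⟫_ℂ :=
  RCLike.nonneg_iff.mpr ⟨inner_self_nonneg, inner_self_im x⟩

theorem conjugation_conjugation (e : HilbertBasis ι ℂ H) (x : H) :
    conjugation e (conjugation e x) = x := by
  simp [conjugation]

/-- Both sides are the symmetric bilinear sum of the products of the coordinates of `x` and `y`. -/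
theorem inner_conjugation_left (e : HilbertBasis ι ℂ H) (x y : H) :
    ⟪conjugation e x, y⟫_ℂ = ⟪conjugation e y, x⟫_ℂ := by
  have h (x y : H) : ⟪conjugation e x, y⟫_ℂ = ∑' i, e.repr x i * e.repr y i := by
    rw [← e.repr.inner_map_map, lp.inner_eq_tsum]
    simp [conjugation, mul_comm]
  rw [h, h]
  simp only [mul_comm]

variable [CompleteSpace H]

/-- Positive matrices are generated by the `star N * N`, whose form is the sum over the rows `l` of
`‖∑ i, N l i (x i)‖ ^ 2`. -/
theorem sum_inner_nonneg_of_nonneg {k : ℕ} {M : CStarMatrix (Fin k) (Fin k) (H →L[ℂ] H)}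
    (hM : 0 ≤ M) (x : Fin k → H) : 0 ≤ ∑ i, ∑ j, ⟪x i, M i j (x j)⟫_ℂ := by
  rw [StarOrderedRing.nonneg_iff] at hM
  induction hM using AddSubmonoid.closure_induction with
  | mem M hM =>
    obtain ⟨N, rfl⟩ := hM
    have h : ∑ i, ∑ j, ⟪x i, (star N * N) i j (x j)⟫_ℂ
        = ∑ l, ⟪∑ i, N l i (x i), ∑ j, N l j (x j)⟫_ℂ := by
      simp only [inner_sum, sum_inner]
      rw [Finset.sum_comm (s := Finset.univ (α := Fin k))]
      refine Eq.trans ?_ (Finset.sum_congr rfl fun _ _ => Finset.sum_comm)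
      rw [Finset.sum_comm]
      refine Eq.trans ?_ Finset.sum_comm
      refine Finset.sum_congr rfl fun i _ => ?_
      refine Eq.trans ?_ Finset.sum_comm
      refine Finset.sum_congr rfl fun j _ => ?_
      simp [CStarMatrix.mul_apply, CStarMatrix.star_apply, _root_.sum_apply,
        ContinuousLinearMap.star_eq_adjoint, ContinuousLinearMap.adjoint_inner_right]
    rw [h]
    exact Finset.sum_nonneg fun l _ => inner_self_nonneg_complex _
  | zero => simp
  | add M N _ _ hM hN =>
    simpa [inner_add_right, Finset.sum_add_distrib] using add_nonneg hM hN

variable {A : Type u} [CStarAlgebra A] [PartialOrder A] [StarOrderedRing A]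

theorem IsCompletelyPositive.isPosDef {φ : A →ₗ[ℂ] (H →L[ℂ] H)} (hφ : IsCompletelyPositive φ) :
    IsPosDef φ := by
  intro k a x
  rcases Nat.eq_zero_or_pos k with rfl | hk
  · simp
  -- With `a` as its only nonzero row, `star N * N` has entries `star (a i) * a j`.
  let N : CStarMatrix (Fin k) (Fin k) A := CStarMatrix.ofMatrix fun i j =>
    if i = ⟨0, hk⟩ then a j else 0
  have h := sum_inner_nonneg_of_nonneg (hφ k (star N * N) (star_mul_self_nonneg N)) x
  have hN (i j : Fin k) : (star N * N) i j = star (a i) * a j := by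
    have hN' (l m : Fin k) : N l m = if l = ⟨0, hk⟩ then a m else 0 := rfl
    simp [CStarMatrix.mul_apply, CStarMatrix.star_apply, hN', apply_ite star]
  simpa only [CStarMatrix.map_apply, hN] using h

theorem inner_transposition (e : HilbertBasis ι ℂ H) (T : H →L[ℂ] H) (x y : H) :
    ⟪conjugation e x, transposition e T (conjugation e y)⟫_ℂ = ⟪y, T x⟫_ℂ := by
  have h : transposition e T (conjugation e y)
      = conjugation e (ContinuousLinearMap.adjoint T y) := by
    simp [transposition, conjugation_conjugation]
  rw [h, inner_conjugation_left, conjugation_conjugation, ContinuousLinearMap.adjoint_inner_left]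

/-- Since `J` is antiunitary, transposition exchanges the two slots of the form. This reverses the
product and gives positive definiteness for the multiplication of `Aᵐᵒᵖ`. -/
theorem IsCompletelyCopositive.sum_nonneg {e : HilbertBasis ι ℂ H} {φ : A →ₗ[ℂ] (H →L[ℂ] H)}
    (hφ : IsCompletelyCopositive e φ) {k : ℕ} (a : Fin k → A) (x : Fin k → H) :
    0 ≤ ∑ i, ∑ j, ⟪x i, φ (a j * star (a i)) (x j)⟫_ℂ := by
  have h := IsCompletelyPositive.isPosDef hφ k (fun i => star (a i))
    (fun i => conjugation e (x i))
  rw [Finset.sum_comm] at h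
  simpa [inner_transposition] using h

/-- The linear map `(a, b) ↦ φ₁ a + φ₂ b` on `A × Aᵐᵒᵖ`. -/
noncomputable def coprodOp (φ₁ φ₂ : A →ₗ[ℂ] (H →L[ℂ] H)) : (A × Aᵐᵒᵖ) →ₗ[ℂ] (H →L[ℂ] H) :=
  φ₁.coprod (φ₂ ∘ₗ (MulOpposite.opLinearEquiv ℂ).symm.toLinearMap)

theorem isPosDef_coprodOp {e : HilbertBasis ι ℂ H} {φ₁ φ₂ : A →ₗ[ℂ] (H →L[ℂ] H)}
    (h₁ : IsCompletelyPositive φ₁) (h₂ : IsCompletelyCopositive e φ₂) :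
    IsPosDef (coprodOp φ₁ φ₂) := by
  intro k b x
  have h := add_nonneg (h₁.isPosDef k (fun i => (b i).1) x)
    (h₂.sum_nonneg (fun i => (b i).2.unop) x)
  simpa [coprodOp, inner_add_right, Finset.sum_add_distrib] using h

/-- The case `k = 1` is ordinary positivity, which brings automatic continuity and compatibility
with the involution. -/
theorem IsPosDef.exists_positiveLinearMap [PartialOrder B] [StarOrderedRing B]
    {Φ : B →ₗ[ℂ] (H →L[ℂ] H)} (hΦ : IsPosDef Φ) :
    ∃ Ψ : B →ₚ[ℂ] (H →L[ℂ] H), ∀ b, Ψ b = Φ b := by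
  refine ⟨PositiveLinearMap.mk₀ Φ fun b hb => ?_, fun b => rfl⟩
  obtain ⟨c, rfl⟩ := CStarAlgebra.nonneg_iff_eq_star_mul_self.mp hb
  rw [ContinuousLinearMap.nonneg_iff_isPositive, ContinuousLinearMap.isPositive_iff_complex]
  intro x
  have h := hΦ 1 (fun _ => c) (fun _ => x)
  simp only [Finset.univ_unique, Finset.sum_const, Finset.card_singleton, one_smul] at h
  have hc := inner_conj_symm (𝕜 := ℂ) (Φ (star c * c) x) x
  have h' := Complex.nonneg_iff.mp h
  simp [Complex.ext_iff, ← hc, h'.1, ← h'.2, -inner_conj_symm]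

theorem IsPosDef.continuous {Φ : B →ₗ[ℂ] (H →L[ℂ] H)} (hΦ : IsPosDef Φ) : Continuous Φ := by
  let := CStarAlgebra.spectralOrder B
  let := CStarAlgebra.spectralOrderedRing B
  obtain ⟨Ψ, hΨ⟩ := hΦ.exists_positiveLinearMap
  exact (map_continuous Ψ).congr hΨ

theorem IsPosDef.map_star {Φ : B →ₗ[ℂ] (H →L[ℂ] H)} (hΦ : IsPosDef Φ) (b : B) :
    Φ (star b) = star (Φ b) := by
  let := CStarAlgebra.spectralOrder B
  let := CStarAlgebra.spectralOrderedRing B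
  obtain ⟨Ψ, hΨ⟩ := hΦ.exists_positiveLinearMap
  simp only [← hΨ, StarHomClass.map_star]

end PosDef

/-! ### Hilbert spaces from positive semidefinite kernels -/

section Kolmogorov

variable {S : Type u}

/-- A positive semidefinite kernel is the Gram kernel of a family of vectors of a Hilbert space
with dense span. -/
theorem exists_kolmogorov (k : S → S → ℂ) (hk : ∀ s t, conj (k s t) = k t s)
    (hpos : ∀ f : S →₀ ℂ, 0 ≤ (f.sum fun s z => f.sum fun t w => conj z * w * k s t).re) :
    ∃ (K : Type u) (_ : NormedAddCommGroup K) (_ : InnerProductSpace ℂ K) (_ : CompleteSpace K)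
      (Γ : S → K), (∀ s t, ⟪Γ s, Γ t⟫_ℂ = k s t) ∧
        DenseRange (Finsupp.linearCombination ℂ Γ) := by
  let c : PreInnerProductSpace.Core ℂ (S →₀ ℂ) :=
    { inner := fun f g => f.sum fun s z => g.sum fun t w => conj z * w * k s t
      conj_inner_symm := fun f g => by
        rw [Finsupp.sum_comm]
        simp only [map_finsuppSum]
        congr! 6
        simp [hk, mul_comm]
      re_inner_nonneg := hpos
      add_left := fun _ _ _ => by
        rw [Finsupp.sum_add_index'] <;> simp [← Finsupp.sum_add, add_mul]
      smul_left := fun _ _ _ => by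
        rw [Finsupp.sum_smul_index] <;> simp [Finsupp.mul_sum, ← mul_assoc] }
  let : SeminormedAddCommGroup (S →₀ ℂ) :=
    InnerProductSpace.Core.toSeminormedAddCommGroup (c := c)
  let : InnerProductSpace ℂ (S →₀ ℂ) := InnerProductSpace.ofCore c
  have hc (f g : S →₀ ℂ) :
      ⟪f, g⟫_ℂ = f.sum fun s z => g.sum fun t w => conj z * w * k s t := rfl
  refine ⟨UniformSpace.Completion (S →₀ ℂ), inferInstance, inferInstance, inferInstance,
    fun s => UniformSpace.Completion.toComplL (𝕜 := ℂ) (Finsupp.single s 1), fun s t => ?_, ?_⟩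
  · simp [hc]
  · have h : ⇑(Finsupp.linearCombination ℂ fun s =>
        UniformSpace.Completion.toComplL (𝕜 := ℂ) (Finsupp.single s (1 : ℂ)))
        = ((↑) : (S →₀ ℂ) → UniformSpace.Completion (S →₀ ℂ)) := by
      ext f
      rw [Finsupp.linearCombination_apply, ← UniformSpace.Completion.coe_toComplL (𝕜 := ℂ)]
      conv_rhs => rw [← Finsupp.sum_single f, map_finsuppSum]
      simp only [← map_smul, Finsupp.smul_single, smul_eq_mul, mul_one]
    rw [h]
    exact UniformSpace.Completion.denseRange_coe

variable {K : Type v} [NormedAddCommGroup K] [InnerProductSpace ℂ K] {Γ : S → K}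

theorem eq_of_forall_inner_eq (hΓ : DenseRange (Finsupp.linearCombination ℂ Γ)) {v w : K}
    (h : ∀ s, ⟪Γ s, v⟫_ℂ = ⟪Γ s, w⟫_ℂ) : v = w := by
  refine hΓ.eq_of_inner_right ℂ ?_
  intro f
  simp only [Finsupp.linearCombination_apply, Finsupp.sum_inner, inner_smul_left, h]

theorem continuousLinearMap_eq_of_forall (hΓ : DenseRange (Finsupp.linearCombination ℂ Γ))
    {F : Type*} [NormedAddCommGroup F] [NormedSpace ℂ F]
    {T T' : K →L[ℂ] F} (h : ∀ s, T (Γ s) = T' (Γ s)) : T = T' := by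
  refine ContinuousLinearMap.coeFn_injective (hΓ.equalizer T.continuous T'.continuous ?_)
  ext f
  simp only [Function.comp, Finsupp.linearCombination_apply, map_finsuppSum, map_smul, h]

/-- A map of the index set that is bounded on finite linear combinations of `Γ` induces a bounded
operator. -/
theorem exists_continuousLinearMap_apply_eq [CompleteSpace K]
    (hΓ : DenseRange (Finsupp.linearCombination ℂ Γ)) (f : S → S) (C : ℝ)
    (hf : ∀ c : S →₀ ℂ, ‖c.sum fun s z => z • Γ (f s)‖ ≤ C * ‖c.sum fun s z => z • Γ s‖) :
    ∃ T : K →L[ℂ] K, ∀ s, T (Γ s) = Γ (f s) := by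
  refine ⟨(Finsupp.linearCombination ℂ (Γ ∘ f)).extendOfNorm (Finsupp.linearCombination ℂ Γ),
    fun s => ?_⟩
  have h := LinearMap.extendOfNorm_eq (f := Finsupp.linearCombination ℂ (Γ ∘ f)) hΓ
    ⟨C, fun c => hf c⟩ (Finsupp.single s 1)
  simpa using h

end Kolmogorov

/-! ### Haar averaging over the compact group -/

section Averaging

open MeasureTheory

variable {B : Type u} [CStarAlgebra B] {G : Type w} [Group G]
  {H : Type v} [NormedAddCommGroup H] [InnerProductSpace ℂ H] [CompleteSpace H]

theorem coe_map_mul_apply (U : G →* unitary (H →L[ℂ] H)) (g h : G) (x : H) :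
    (U (g * h) : H →L[ℂ] H) x = (U g : H →L[ℂ] H) ((U h : H →L[ℂ] H) x) := by
  simp

theorem star_coe_map (U : G →* unitary (H →L[ℂ] H)) (g : G) :
    star (U g : H →L[ℂ] H) = (U g⁻¹ : H →L[ℂ] H) := by
  rw [map_inv, ← Unitary.star_eq_inv, Unitary.coe_star]

theorem inner_map_right (U : G →* unitary (H →L[ℂ] H)) (g : G) (x y : H) :
    ⟪x, (U g : H →L[ℂ] H) y⟫_ℂ = ⟪(U g⁻¹ : H →L[ℂ] H) x, y⟫_ℂ := by
  rw [← star_coe_map, ContinuousLinearMap.star_eq_adjoint, ContinuousLinearMap.adjoint_inner_left]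

theorem norm_coe_map_apply (U : G →* unitary (H →L[ℂ] H)) (g : G) (x : H) :
    ‖(U g : H →L[ℂ] H) x‖ = ‖x‖ :=
  Unitary.norm_map (U g) x

theorem norm_action (α : G →* (B ≃⋆ₐ[ℂ] B)) (g : G) (b : B) : ‖α g b‖ = ‖b‖ :=
  StarAlgEquiv.norm_map (α g) b

variable [TopologicalSpace G]

/-- Strong continuity upgrades to joint continuity because every `U g` is isometric. -/
theorem IsContinuousRep.continuous_apply {U : G →* unitary (H →L[ℂ] H)} (hU : IsContinuousRep U)
    {X : Type*} [TopologicalSpace X] {g : X → G} {f : X → H} (hg : Continuous g)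
    (hf : Continuous f) : Continuous fun t => (U (g t) : H →L[ℂ] H) (f t) := by
  rw [continuous_iff_continuousAt]
  intro t
  rw [ContinuousAt, tendsto_iff_norm_sub_tendsto_zero]
  have h₁ := tendsto_iff_norm_sub_tendsto_zero.mp (hf.tendsto t)
  have h₂ := tendsto_iff_norm_sub_tendsto_zero.mp (((hU (f t)).comp hg).tendsto t)
  refine squeeze_zero (fun _ => norm_nonneg _) (fun s => ?_) (by simpa using h₁.add h₂)
  calc _ = ‖(U (g s) : H →L[ℂ] H) (f s - f t)
          + ((U (g s) : H →L[ℂ] H) (f t) - (U (g t) : H →L[ℂ] H) (f t))‖ := by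
        congr 1; simp
    _ ≤ _ := (norm_add_le _ _).trans_eq (by rw [norm_coe_map_apply])

variable [IsTopologicalGroup G]

/-- The orbit map `h ↦ U(h) Φ(h⁻¹(b)) U(h)* y` over which an average is taken. -/
noncomputable def conjOrbit (α : G →* (B ≃⋆ₐ[ℂ] B)) (U : G →* unitary (H →L[ℂ] H)) (Φ : B →ₗ[ℂ] (H →L[ℂ] H))
    (b : B) (y : H) (h : G) : H :=
  (U h : H →L[ℂ] H) (Φ (α h⁻¹ b) ((U h⁻¹ : H →L[ℂ] H) y))

theorem continuous_conjOrbit {α : G →* (B ≃⋆ₐ[ℂ] B)} (hα : IsContinuousAction α)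
    {U : G →* unitary (H →L[ℂ] H)} (hU : IsContinuousRep U) {Φ : B →ₗ[ℂ] (H →L[ℂ] H)}
    (hΦ : Continuous Φ) (b : B) (y : H) : Continuous (conjOrbit α U Φ b y) :=
  hU.continuous_apply continuous_id <|
    (hΦ.comp ((hα b).comp continuous_inv)).clm_apply ((hU y).comp continuous_inv)

/-- Averaging over a compact group makes a positive definite map covariant, without changing the
values at the points where it is covariant already. -/
theorem IsPosDef.exists_covariant [CompactSpace G] {α : G →* (B ≃⋆ₐ[ℂ] B)}
    (hα : IsContinuousAction α) {U : G →* unitary (H →L[ℂ] H)} (hU : IsContinuousRep U)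
    {Φ : B →ₗ[ℂ] (H →L[ℂ] H)} (hΦ : IsPosDef Φ) :
    ∃ Ψ : B →ₗ[ℂ] (H →L[ℂ] H), IsPosDef Ψ ∧ IsCovariant α U Ψ ∧
      ∀ b, (∀ g, Φ (α g b) = Ad (U g) (Φ b)) → Ψ b = Φ b := by
  borelize G
  -- Normalizing on the whole compact group gives total mass one, so averaging fixes constants.
  let μ : Measure G := Measure.haarMeasure ⊤
  have : IsProbabilityMeasure μ :=
    ⟨Measure.haarMeasure_self (K₀ := (⊤ : TopologicalSpace.PositiveCompacts G))⟩
  have hc := continuous_conjOrbit hα hU hΦ.continuous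
  have hint (b : B) (y : H) : Integrable (conjOrbit α U Φ b y) μ :=
    (hc b y).integrable_of_hasCompactSupport (HasCompactSupport.of_compactSpace _)
  obtain ⟨C, hC0, hC⟩ : ∃ C, 0 ≤ C ∧ ∀ b, ‖Φ b‖ ≤ C * ‖b‖ :=
    ⟨‖(⟨Φ, hΦ.continuous⟩ : B →L[ℂ] (H →L[ℂ] H))‖, norm_nonneg _,
      (⟨Φ, hΦ.continuous⟩ : B →L[ℂ] (H →L[ℂ] H)).le_opNorm⟩
  have hbound (b : B) (y : H) (h : G) : ‖conjOrbit α U Φ b y h‖ ≤ C * ‖b‖ * ‖y‖ := by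
    rw [conjOrbit, norm_coe_map_apply]
    refine (ContinuousLinearMap.le_opNorm _ _).trans ?_
    rw [norm_coe_map_apply]
    gcongr
    exact (hC _).trans_eq (by rw [norm_action])
  let Ψ₀ (b : B) : H →L[ℂ] H := LinearMap.mkContinuous
    { toFun := fun y => ∫ h, conjOrbit α U Φ b y h ∂μ
      map_add' := fun x y => by
        rw [← integral_add (hint b x) (hint b y)]
        simp [conjOrbit]
      map_smul' := fun c x => by
        rw [RingHom.id_apply, ← integral_smul]
        simp [conjOrbit] } (C * ‖b‖) fun y => by
          simpa using norm_integral_le_of_norm_le_const (μ := μ)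
            (Filter.Eventually.of_forall (hbound b y))
  have hΨ₀ (b : B) (y : H) : Ψ₀ b y = ∫ h, conjOrbit α U Φ b y h ∂μ := rfl
  let Ψ : B →ₗ[ℂ] (H →L[ℂ] H) :=
    { toFun := Ψ₀
      map_add' := fun b c => by
        ext y
        rw [_root_.add_apply, hΨ₀, hΨ₀, hΨ₀, ← integral_add (hint b y) (hint c y)]
        simp [conjOrbit]
      map_smul' := fun z b => by
        ext y
        rw [RingHom.id_apply, _root_.smul_apply, hΨ₀, hΨ₀, ← integral_smul]
        simp [conjOrbit] }
  have hΨ (b : B) (y : H) : Ψ b y = ∫ h, conjOrbit α U Φ b y h ∂μ := rfl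
  refine ⟨Ψ, fun k b x => ?_, fun g b => ?_, fun b hb => ?_⟩
  · have hi (i j : Fin k) : Integrable
        (fun h => ⟪x i, conjOrbit α U Φ (star (b i) * b j) (x j) h⟫_ℂ) μ :=
      (hint _ _).const_inner _
    have hs : ∑ i, ∑ j, ⟪x i, Ψ (star (b i) * b j) (x j)⟫_ℂ
        = ∫ h, ∑ i, ∑ j, ⟪x i, conjOrbit α U Φ (star (b i) * b j) (x j) h⟫_ℂ ∂μ := by
      rw [integral_finsetSum _ fun i _ => integrable_finsetSum _ fun j _ => hi i j]
      refine Finset.sum_congr rfl fun i _ => ?_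
      rw [integral_finsetSum _ fun j _ => hi i j]
      refine Finset.sum_congr rfl fun j _ => ?_
      rw [hΨ, integral_inner (hint _ _)]
    rw [hs]
    -- For each `h` the integrand is the form of `Φ` at the translated points `α h⁻¹ (b i)` and `U
    -- h⁻¹ (x i)`.
    refine integral_nonneg fun h => ?_
    change (0 : ℂ) ≤ _
    simpa only [conjOrbit, inner_map_right, map_mul, StarHomClass.map_star] using
      hΦ k (fun i => α h⁻¹ (b i)) (fun i => (U h⁻¹ : H →L[ℂ] H) (x i))
  · ext y
    rw [hΨ, Ad, star_coe_map]
    change _ = (U g : H →L[ℂ] H) (Ψ b ((U g⁻¹ : H →L[ℂ] H) y))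
    -- Left invariance of Haar measure: substituting `g * h` for `h` pulls `U g` out of the
    -- integral.
    rw [hΨ, ← integral_mul_left_eq_self _ g, ← ContinuousLinearMap.integral_comp_comm _ (hint _ _)]
    refine integral_congr_ae (Filter.Eventually.of_forall fun h => ?_)
    have e : α (h⁻¹ * g⁻¹) (α g b) = α h⁻¹ b := by
      rw [← StarAlgEquiv.mul_apply, ← map_mul, inv_mul_cancel_right]
    simp only [conjOrbit, e, mul_inv_rev, coe_map_mul_apply]
  · ext y
    have e (h : G) : conjOrbit α U Φ b y h = Φ b y := by
      rw [conjOrbit, hb, Ad, star_coe_map, inv_inv]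
      change (U h : H →L[ℂ] H) ((U h⁻¹ : H →L[ℂ] H) (Φ b
        ((U h : H →L[ℂ] H) ((U h⁻¹ : H →L[ℂ] H) y)))) = _
      simp only [← coe_map_mul_apply]
      simp
    simp [hΨ, e]

end Averaging

/-! ### Covariant Stinespring dilation -/

section Stinespring

variable {B : Type u} [CStarAlgebra B] {G : Type w} [Group G] [TopologicalSpace G]
  {H : Type v} [NormedAddCommGroup H] [InnerProductSpace ℂ H] [CompleteSpace H]

theorem norm_sq_sum_smul {S : Type*} {K : Type*} [NormedAddCommGroup K] [InnerProductSpace ℂ K]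
    (c : S →₀ ℂ) (v : S → K) : ((‖c.sum fun s z => z • v s‖ ^ 2 : ℝ) : ℂ)
      = c.sum fun s z => c.sum fun t w => conj z * w * ⟪v s, v t⟫_ℂ := by
  have h := inner_self_eq_norm_sq_to_K (𝕜 := ℂ) (c.sum fun s z => z • v s)
  rw [Complex.ofReal_pow]
  refine h.symm.trans ?_
  simp only [Finsupp.sum_inner, Finsupp.inner_sum, inner_smul_left, inner_smul_right,
    Finsupp.mul_sum, mul_assoc]
  rw [Finsupp.sum_comm]
  exact Finsupp.sum_congr fun _ _ => Finsupp.sum_congr fun _ _ => mul_left_comm _ _ _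

/-- The generating vectors `b ⊗ x` of the Stinespring space of a positive definite map. -/
theorem IsPosDef.exists_stinespring_vectors {Φ : B →ₗ[ℂ] (H →L[ℂ] H)} (hΦ : IsPosDef Φ) :
    ∃ (K : Type (max u v)) (_ : NormedAddCommGroup K) (_ : InnerProductSpace ℂ K)
      (_ : CompleteSpace K) (Γ : B × H → K),
      (∀ s t, ⟪Γ s, Γ t⟫_ℂ = ⟪s.2, Φ (star s.1 * t.1) t.2⟫_ℂ) ∧
        DenseRange (Finsupp.linearCombination ℂ Γ) := by
  refine exists_kolmogorov (fun s t : B × H => ⟪s.2, Φ (star s.1 * t.1) t.2⟫_ℂ)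
    (fun s t => ?_) fun f => ?_
  · rw [inner_conj_symm, ← ContinuousLinearMap.adjoint_inner_right,
      ← ContinuousLinearMap.star_eq_adjoint, ← hΦ.map_star, star_mul, star_star]
  · have h := hΦ.sum_nonneg f.support (fun s => s.1) (fun s => f s • s.2)
    refine (Complex.nonneg_iff.mp (h.trans_eq ?_)).1
    simp only [Finsupp.sum, inner_smul_left, inner_smul_right, map_smul, mul_assoc]
    exact Finset.sum_congr rfl fun _ _ => Finset.sum_congr rfl fun _ _ => mul_left_comm _ _ _

/-- `‖b‖ ^ 2 - star b * b` is positive, hence of the form `star d * d`. This bounds left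
multiplication by `b` on the Stinespring space. -/
theorem exists_star_mul_self_add (b : B) :
    ∃ d : B, star b * b + star d * d = ((‖b‖ ^ 2 : ℝ) : ℂ) • (1 : B) := by
  let := CStarAlgebra.spectralOrder B
  let := CStarAlgebra.spectralOrderedRing B
  have h : star b * b ≤ algebraMap ℝ B (‖b‖ ^ 2) := by
    rw [sq, ← CStarRing.norm_star_mul_self]
    exact IsSelfAdjoint.le_algebraMap_norm_self (.star_mul_self b)
  obtain ⟨d, hd⟩ := CStarAlgebra.nonneg_iff_eq_star_mul_self.mp (sub_nonneg.mpr h)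
  refine ⟨d, ?_⟩
  rw [← hd, add_sub_cancel, Algebra.algebraMap_eq_smul_one, Complex.coe_smul]

/-- The covariant Stinespring theorem. -/
theorem IsPosDef.exists_covariant_dilation {α : G →* (B ≃⋆ₐ[ℂ] B)}
    (hα : IsContinuousAction α) {U : G →* unitary (H →L[ℂ] H)} (hU : IsContinuousRep U)
    {Φ : B →ₗ[ℂ] (H →L[ℂ] H)} (hΦ : IsPosDef Φ) (hc : IsCovariant α U Φ) :
    ∃ (K : Type (max u v)) (_ : NormedAddCommGroup K) (_ : InnerProductSpace ℂ K)
      (_ : CompleteSpace K) (π : B →ₗ[ℂ] (K →L[ℂ] K)) (V : H →L[ℂ] K)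
      (Z : G →* unitary (K →L[ℂ] K)),
      (∀ b, π (star b) = star (π b)) ∧ (∀ b c, π (b * c) = π b * π c) ∧
      IsContinuousRep Z ∧
      (∀ b, Φ b = (ContinuousLinearMap.adjoint V).comp ((π b).comp V)) ∧
      IsCovariant α Z π ∧
      (∀ g, V.comp (U g : H →L[ℂ] H) = (Z g : K →L[ℂ] K).comp V) := by
  obtain ⟨K, _, _, _, Γ, hΓ, hd⟩ := hΦ.exists_stinespring_vectors
  -- linearity of the generating family
  have hΓb (b c : B) (x : H) : Γ (b + c, x) = Γ (b, x) + Γ (c, x) :=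
    eq_of_forall_inner_eq hd fun s => by simp [hΓ, mul_add]
  have hΓbs (z : ℂ) (b : B) (x : H) : Γ (z • b, x) = z • Γ (b, x) :=
    eq_of_forall_inner_eq hd fun s => by simp [hΓ]
  have hΓx (b : B) (x y : H) : Γ (b, x + y) = Γ (b, x) + Γ (b, y) :=
    eq_of_forall_inner_eq hd fun s => by simp [hΓ]
  have hΓxs (z : ℂ) (b : B) (x : H) : Γ (b, z • x) = z • Γ (b, x) :=
    eq_of_forall_inner_eq hd fun s => by simp [hΓ]
  obtain ⟨C, hC0, hC⟩ : ∃ C, 0 ≤ C ∧ ∀ b, ‖Φ b‖ ≤ C * ‖b‖ :=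
    ⟨‖(⟨Φ, hΦ.continuous⟩ : B →L[ℂ] (H →L[ℂ] H))‖, norm_nonneg _,
      (⟨Φ, hΦ.continuous⟩ : B →L[ℂ] (H →L[ℂ] H)).le_opNorm⟩
  have hΓn (b : B) (x : H) : ‖Γ (b, x)‖ ≤ √C * ‖b‖ * ‖x‖ := by
    rw [← sq_le_sq₀ (norm_nonneg _) (by positivity), ← inner_self_eq_norm_sq (𝕜 := ℂ), hΓ,
      mul_pow, mul_pow, Real.sq_sqrt hC0]
    calc RCLike.re ⟪x, Φ (star b * b) x⟫_ℂ ≤ ‖x‖ * ‖Φ (star b * b) x‖ := re_inner_le_norm _ _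
      _ ≤ ‖x‖ * (‖Φ (star b * b)‖ * ‖x‖) := by gcongr; exact ContinuousLinearMap.le_opNorm _ _
      _ ≤ ‖x‖ * (C * ‖star b * b‖ * ‖x‖) := by gcongr; exact hC _
      _ = _ := by rw [CStarRing.norm_star_mul_self]; ring
  -- The bounded bilinear form of `Γ` yields both `V = Γ₂ 1` and the joint continuity behind strong
  -- continuity of `Z`.
  let Γ₂ : B →L[ℂ] H →L[ℂ] K := LinearMap.mkContinuous₂
    (LinearMap.mk₂ ℂ (fun b x => Γ (b, x)) hΓb hΓbs hΓx fun z b x => hΓxs z b x) (√C) hΓn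
  -- the representation of the algebra
  have hP (b : B) : ∃ T : K →L[ℂ] K, ∀ s, T (Γ s) = Γ (b * s.1, s.2) := by
    refine exists_continuousLinearMap_apply_eq hd (fun s => (b * s.1, s.2)) ‖b‖ fun c => ?_
    obtain ⟨d, hbd⟩ := exists_star_mul_self_add b
    -- For `ξ` in the span of `Γ`, this reads `‖b ξ‖ ^ 2 + ‖d ξ‖ ^ 2 = ‖b‖ ^ 2 * ‖ξ‖ ^ 2`, so `‖b ξ‖
    -- ≤ ‖b‖ * ‖ξ‖`.
    have key : ((‖c.sum fun s z => z • Γ (b * s.1, s.2)‖ ^ 2 : ℝ) : ℂ)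
        + ((‖c.sum fun s z => z • Γ (d * s.1, s.2)‖ ^ 2 : ℝ) : ℂ)
        = ((‖b‖ ^ 2 * ‖c.sum fun s z => z • Γ s‖ ^ 2 : ℝ) : ℂ) := by
      rw [norm_sq_sum_smul, norm_sq_sum_smul, Complex.ofReal_mul, norm_sq_sum_smul, Finsupp.mul_sum, ← Finsupp.sum_add]
      refine Finsupp.sum_congr fun s _ => ?_
      rw [Finsupp.mul_sum, ← Finsupp.sum_add]
      refine Finsupp.sum_congr fun t _ => ?_
      have e : star (b * s.1) * (b * t.1) + star (d * s.1) * (d * t.1)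
          = ((‖b‖ ^ 2 : ℝ) : ℂ) • (star s.1 * t.1) := by
        calc _ = star s.1 * (star b * b + star d * d) * t.1 := by
              simp only [star_mul]; noncomm_ring
          _ = _ := by rw [hbd]; simp
      have e' := congrArg (fun a => ⟪s.2, Φ a t.2⟫_ℂ) e
      simp only [map_add, map_smul, _root_.add_apply, _root_.smul_apply, inner_add_right,
        inner_smul_right] at e'
      simp only [hΓ]
      rw [← mul_add, e']
      ring
    have key' := by exact_mod_cast key
    rw [← sq_le_sq₀ (norm_nonneg _) (by positivity), mul_pow, ← key']
    exact le_add_of_nonneg_right (sq_nonneg _)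
  choose P hPΓ using hP
  let π : B →ₗ[ℂ] (K →L[ℂ] K) :=
    { toFun := P
      map_add' := fun b c => continuousLinearMap_eq_of_forall hd fun s => by
        simp [hPΓ, add_mul, hΓb]
      map_smul' := fun z b => continuousLinearMap_eq_of_forall hd fun s => by
        simp [hPΓ, hΓbs] }
  have hπ (b c : B) (x : H) : π b (Γ (c, x)) = Γ (b * c, x) := hPΓ b (c, x)
  -- the representation of the group
  have hα_cancel (g : G) (b : B) : α g⁻¹ (α g b) = b := by
    rw [← StarAlgEquiv.mul_apply, ← map_mul, inv_mul_cancel, map_one, StarAlgEquiv.one_apply]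
  have hU_cancel (g : G) (x : H) : (U g⁻¹ : H →L[ℂ] H) ((U g : H →L[ℂ] H) x) = x := by
    rw [← coe_map_mul_apply, inv_mul_cancel, map_one]
    rfl
  -- Covariance of `Φ` is exactly what makes the Gram kernel invariant under the group.
  have hΓg (g : G) (s t : B × H) : ⟪Γ (α g s.1, (U g : H →L[ℂ] H) s.2),
      Γ (α g t.1, (U g : H →L[ℂ] H) t.2)⟫_ℂ = ⟪Γ s, Γ t⟫_ℂ := by
    simp only [hΓ]
    rw [← StarHomClass.map_star, ← map_mul, hc, Ad, star_coe_map]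
    change ⟪_, (U g : H →L[ℂ] H) (Φ _ ((U g⁻¹ : H →L[ℂ] H) _))⟫_ℂ = _
    rw [inner_map_right, hU_cancel, hU_cancel]
  have hQ (g : G) : ∃ T : K →L[ℂ] K, ∀ s, T (Γ s) = Γ (α g s.1, (U g : H →L[ℂ] H) s.2) := by
    refine exists_continuousLinearMap_apply_eq hd (fun s => (α g s.1, (U g : H →L[ℂ] H) s.2)) 1
      fun c => ?_
    rw [one_mul, ← sq_le_sq₀ (norm_nonneg _) (norm_nonneg _)]
    refine le_of_eq (Complex.ofReal_injective ?_)
    simp only [norm_sq_sum_smul, hΓg]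
  choose Q hQΓ using hQ
  have hQ_mul (g h : G) : Q (g * h) = Q g * Q h :=
    continuousLinearMap_eq_of_forall hd fun s => by
      change _ = Q g (Q h (Γ s))
      simp only [hQΓ, coe_map_mul_apply, map_mul α, StarAlgEquiv.mul_apply]
  have hQ_one : Q 1 = 1 := continuousLinearMap_eq_of_forall hd fun s => by
    rw [hQΓ, map_one, map_one]
    rfl
  have hQ_star (g : G) : star (Q g) = Q g⁻¹ :=
    continuousLinearMap_eq_of_forall hd fun s => eq_of_forall_inner_eq hd fun t => by
      rw [ContinuousLinearMap.star_eq_adjoint, ContinuousLinearMap.adjoint_inner_right, hQΓ, hQΓ,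
        ← hΓg g⁻¹]
      simp only [hα_cancel, hU_cancel]
  let Z : G →* unitary (K →L[ℂ] K) := MonoidHom.mk'
    (fun g => ⟨Q g, by
      rw [Unitary.mem_iff, hQ_star, ← hQ_mul, ← hQ_mul, inv_mul_cancel, mul_inv_cancel, hQ_one]
      exact ⟨rfl, rfl⟩⟩) fun g h => Subtype.ext (hQ_mul g h)
  have hZ (g : G) (b : B) (x : H) :
      (Z g : K →L[ℂ] K) (Γ (b, x)) = Γ (α g b, (U g : H →L[ℂ] H) x) := hQΓ g (b, x)
  have hV (x : H) : Γ₂ 1 x = Γ (1, x) := rfl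
  refine ⟨K, inferInstance, inferInstance, inferInstance, π, Γ₂ 1, Z, fun b => ?_, fun b c => ?_,
    fun v => ?_, fun b => ?_, fun g b => ?_, fun g => ?_⟩
  · refine continuousLinearMap_eq_of_forall hd fun s => eq_of_forall_inner_eq hd fun t => ?_
    rw [ContinuousLinearMap.star_eq_adjoint, ContinuousLinearMap.adjoint_inner_right, hπ, hπ]
    simp only [hΓ, star_mul, mul_assoc]
  · refine continuousLinearMap_eq_of_forall hd fun s => ?_
    change _ = π b (π c (Γ s))
    rw [hπ, hπ, hπ, mul_assoc]
  -- As every `Z g` is isometric, the orbit map of `v` is a uniform limit of orbit maps of vectors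
  -- in the dense span.
  · refine continuous_of_uniform_approx_of_continuous fun u hu => ?_
    obtain ⟨ε, hε, hεu⟩ := Metric.mem_uniformity_dist.mp hu
    obtain ⟨c, hcv⟩ := hd.exists_dist_lt v hε
    refine ⟨fun g => (Z g : K →L[ℂ] K) (Finsupp.linearCombination ℂ Γ c), ?_, fun g => hεu ?_⟩
    · simp only [Finsupp.linearCombination_apply, map_finsuppSum, map_smul]
      refine continuous_finsetSum _ fun s _ => Continuous.const_smul ?_ _
      exact ((Γ₂.continuous.comp (hα s.1)).clm_apply (hU s.2)).congr fun g => (hZ g s.1 s.2).symm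
    · rw [dist_eq_norm, ← map_sub, norm_coe_map_apply, ← dist_eq_norm]
      exact hcv
  · ext y
    refine ext_inner_left ℂ fun x => ?_
    change _ = ⟪x, ContinuousLinearMap.adjoint (Γ₂ 1) (π b (Γ₂ 1 y))⟫_ℂ
    rw [ContinuousLinearMap.adjoint_inner_right, hV, hV, hπ, hΓ]
    simp only [star_one, mul_one, one_mul]
  · refine continuousLinearMap_eq_of_forall hd fun s => ?_
    rw [Ad, star_coe_map]
    change _ = (Z g : K →L[ℂ] K) (π b ((Z g⁻¹ : K →L[ℂ] K) (Γ s)))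
    have hα_cancel' := hα_cancel g⁻¹ s.1
    have hU_cancel' := hU_cancel g⁻¹ s.2
    rw [inv_inv] at hα_cancel' hU_cancel'
    rw [hπ, hZ, hπ, hZ, map_mul, hα_cancel', hU_cancel']
  · ext x
    change Γ₂ 1 ((U g : H →L[ℂ] H) x) = (Z g : K →L[ℂ] K) (Γ₂ 1 x)
    rw [hV, hV, hZ, map_one]

end Stinespring

/-! ### The diagonal Jordan embedding and the main theorem -/

section Main

variable {A : Type u} [CStarAlgebra A] {G : Type w} [Group G]

/-- The action on the product of a C*-algebra and its opposite induced by an action. -/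
noncomputable def prodOpAction (α : G →* (A ≃⋆ₐ[ℂ] A)) : G →* ((A × Aᵐᵒᵖ) ≃⋆ₐ[ℂ] (A × Aᵐᵒᵖ)) where
  toFun g :=
    { toFun := fun b => (α g b.1, .op (α g b.2.unop))
      invFun := fun b => ((α g).symm b.1, .op ((α g).symm b.2.unop))
      left_inv := fun b => by simp
      right_inv := fun b => by simp
      map_mul' := fun b c => by simp
      map_add' := fun b c => by simp
      map_smul' := fun z b => by ext <;> simp
      map_star' := fun b => by ext <;> simp [StarHomClass.map_star] }
  map_one' := by ext <;> simp
  map_mul' g h := by ext <;> simp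

/-- The Jordan embedding of an algebra into its product with the opposite algebra. -/
noncomputable def diagOp : A →ₗ[ℂ] A × Aᵐᵒᵖ :=
  LinearMap.prod LinearMap.id (MulOpposite.opLinearEquiv ℂ).toLinearMap

theorem diagOp_apply (a : A) : diagOp a = (a, .op a) := rfl

theorem coprodOp_diagOp {H : Type v} [NormedAddCommGroup H] [InnerProductSpace ℂ H]
    [CompleteSpace H] (φ₁ φ₂ : A →ₗ[ℂ] (H →L[ℂ] H)) (a : A) :
    coprodOp φ₁ φ₂ (diagOp a) = φ₁ a + φ₂ a := by
  simp [coprodOp, diagOp_apply]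

theorem isCovariant_of_dilation {H : Type v} [NormedAddCommGroup H] [InnerProductSpace ℂ H]
    [CompleteSpace H] {K : Type*} [NormedAddCommGroup K] [InnerProductSpace ℂ K]
    [CompleteSpace K] {α : G →* (A ≃⋆ₐ[ℂ] A)} {U : G →* unitary (H →L[ℂ] H)}
    {Z : G →* unitary (K →L[ℂ] K)} {φ : A →ₗ[ℂ] (H →L[ℂ] H)} {π : A →ₗ[ℂ] (K →L[ℂ] K)}
    {V : H →L[ℂ] K} (hφ : ∀ a, φ a = (ContinuousLinearMap.adjoint V).comp ((π a).comp V))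
    (hπ : IsCovariant α Z π)
    (hV : ∀ g, V.comp (U g : H →L[ℂ] H) = (Z g : K →L[ℂ] K).comp V) : IsCovariant α U φ := by
  intro g a
  ext y
  refine ext_inner_left ℂ fun x => ?_
  have hVU (g : G) (x : H) : V ((U g : H →L[ℂ] H) x) = (Z g : K →L[ℂ] K) (V x) :=
    DFunLike.congr_fun (hV g) x
  rw [hφ, hπ, Ad, Ad, star_coe_map, star_coe_map, hφ]
  change ⟪x, ContinuousLinearMap.adjoint V
      ((Z g : K →L[ℂ] K) (π a ((Z g⁻¹ : K →L[ℂ] K) (V y))))⟫_ℂ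
    = ⟪x, (U g : H →L[ℂ] H) (ContinuousLinearMap.adjoint V
      (π a (V ((U g⁻¹ : H →L[ℂ] H) y))))⟫_ℂ
  rw [inner_map_right, ContinuousLinearMap.adjoint_inner_right,
    ContinuousLinearMap.adjoint_inner_right, inner_map_right, hVU, hVU]

end Main

end CovariantDecomposable

open CovariantDecomposable in
theorem mainTheorem1
    {A : Type u} [CStarAlgebra A] [PartialOrder A] [StarOrderedRing A]
    {H : Type v} [NormedAddCommGroup H] [InnerProductSpace ℂ H] [CompleteSpace H]
    {ι : Type*} (e : HilbertBasis ι ℂ H)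
    {G : Type w} [Group G] [TopologicalSpace G] [IsTopologicalGroup G] [CompactSpace G]
    (α : G →* (A ≃⋆ₐ[ℂ] A)) (hα : CovariantDecomposable.IsContinuousAction α)
    (U : G →* unitary (H →L[ℂ] H)) (hU : CovariantDecomposable.IsContinuousRep U)
    (φ : A →ₗ[ℂ] (H →L[ℂ] H)) (hφ : CovariantDecomposable.IsDecomposable e φ) :
    CovariantDecomposable.IsCovariant α U φ ↔
      ∃ (K : Type (max u v)) (_ : NormedAddCommGroup K) (_ : InnerProductSpace ℂ K)
        (_ : CompleteSpace K) (π : A →ₗ[ℂ] (K →L[ℂ] K)) (V : H →L[ℂ] K)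
        (Z : G →* unitary (K →L[ℂ] K)),
        CovariantDecomposable.IsJordanMorphism π ∧
        CovariantDecomposable.IsContinuousRep Z ∧
        (∀ a, φ a = (ContinuousLinearMap.adjoint V).comp ((π a).comp V)) ∧
        CovariantDecomposable.IsCovariant α Z π ∧
        (∀ g, V.comp (U g : H →L[ℂ] H) = (Z g : K →L[ℂ] K).comp V) := by
  
  constructor
  · intro hcov
    obtain ⟨φ₁, φ₂, h₁, h₂, rfl⟩ := hφ
    have hβ : IsContinuousAction (prodOpAction α) := fun b =>
      (hα b.1).prodMk (MulOpposite.continuous_op.comp (hα b.2.unop))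
    obtain ⟨Ψ, hΨ, hΨc, hΨe⟩ := (isPosDef_coprodOp h₁ h₂).exists_covariant hβ hU
    obtain ⟨K, _, _, _, π, V, Z, hs, hm, hZ, hd, hπ, hV⟩ := hΨ.exists_covariant_dilation hβ hU hΨc
    have hj (g : G) (a : A) : prodOpAction α g (diagOp a) = diagOp (α g a) := rfl
    refine ⟨K, inferInstance, inferInstance, inferInstance, π ∘ₗ diagOp, V, Z,
      ⟨fun a => hs (diagOp a), fun a b => ?_⟩, hZ, fun a => ?_, fun g a => hπ g (diagOp a), hV⟩
    -- The opposite factor swaps the two products, which the Jordan sum does not see.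
    · have e : diagOp (a * b + b * a) = diagOp a * diagOp b + diagOp b * diagOp a := by
        simp [diagOp_apply, add_comm]
      rw [LinearMap.comp_apply, e, map_add, hm, hm]
      rfl
    -- The diagonal is stable under the action, so covariance of `φ` is covariance of `Φ` there, and
    -- averaging has not changed those values.
    · rw [LinearMap.comp_apply, ← hd, hΨe _ fun g => ?_, coprodOp_diagOp]
      · rfl
      · simpa only [hj, coprodOp_diagOp, LinearMap.add_apply] using hcov g a
  · rintro ⟨K, _, _, _, π, V, Z, -, -, hφV, hπ, hV⟩
    exact isCovariant_of_dilation hφV hπ hV
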